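/- Let $\mathcal C$ and $\mathcal P$ be disjoint finite sets (customers and providers), $\mathcal A=\mathcal C\cup\mathcal P$, and let $u:\mathcal A\times\mathcal A\to[-1,1]$ be a utility function with $u_a(a)=0$ for all $a$ (otherwise arbitrary: "unstructured preferences"). A matching $X$ is a set of pairwise disjoint pairs in $\mathcal C\times\mathcal P$; $\mu_X(a)$ is the partner of $a$ in $X$, with $\mu_X(a)=a$ if $a$ is unmatched; $\mathscr X_S$ is the set of matchings among the agents of $S\subseteq\mathcal A$. For a set $A$ of agents, a matching $X\in\mathscr X_A$ and transfers $\tau\in\mathbb R^A$, the *Subset Instability* is $$I(X,\tau;u,A)=\max_{S\subseteq A}\Big[\max_{X'\in\mathscr X_S}\sum_{a\in S}u_a(\mu_{X'}(a))-\sum_{a\in S}\big(u_a(\mu_X(a))+\tau_a\big)\Big].$$ *Bandit model.* In each round $t=1,\dots,T$ a set $A^t\subseteq\mathcal A$ of agents arrives, a market outcome $(X^t,\tau^t)$ with $X^t\in\mathscr X_{A^t}$ is selected, and then $u_a(\mu_{X^t}(a))+\varepsilon_{a,t}$ is observed for each $a\in A^t$. The $\varepsilon_{a,t}$ are independent and $1$-subgaussian,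 i.e. $\mathbb E\,e^{\lambda\varepsilon_{a,t}}\le e^{\lambda^2/2}$ for all $\lambda\in\mathbb R$. The arrivals and the choice of the outcome may depend on the past and on additional randomness: $A^t,X^t,\tau^t$ are measurable with respect to a $\sigma$-algebra $\mathcal F_t$, increasing in $t$, that contains the information on the noise of the earlier rounds and is independent of the noise of round $t$. Let $n$ be the maximum number of agents arriving in a round (or any integer with $|A^t|\le n$ for all $t$). The regret is $R_T=\sum_{t=1}^T I(X^t,\tau^t;u,A^t)$. *MatchUCB.* For agents $a,a'$ on opposite sides, let $n_{aa'}$ be the number of rounds before $t$ in which they were matched, and $\hat u_a(a')$ the mean of the feedback of $a$ in those rounds. The confidence set $C_{a,a'}$ is $[-1,1]$ if $n_{aa'}=0$, and otherwise $$C_{a,a'}=\Big[\hat u_a(a')-8\sqrt{\log(|\mathcal A|T)/n_{aa'}},\ \hat u_a(a')+8\sqrt{\log(|\mathcal A|T)/n_{aa'}}\Big]\cap[-1,1].$$ Let $w_a(a')=\max C_{a,a'}$ (any value in $[-1,1]$ if $C_{a,a'}=\emptyset$) and $w_a(a)=0$. In round $t$ the algorithm takes any matching $X^t\in\mathscr X_{A^t}$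 and any prices $p\in\mathbb R^{A^t}$ that form an optimal primal-dual pair for the utilities $w$. That is, the indicator matrix of $X^t$ maximizes $\sum_{c,q}Z_{cq}(w_c(q)+w_q(c))$ subject to $\sum_qZ_{cq}\le1$, $\sum_cZ_{cq}\le1$, $Z_{cq}\ge0$, and $p$ minimizes $\sum_{a\in A^t}p_a$ subject to $p_c+p_q\ge w_c(q)+w_q(c)$, $p_a\ge0$, where $c$ ranges over $A^t\cap\mathcal C$, $q$ over $A^t\cap\mathcal P$ and $a$ over $A^t$. It sets $\tau^t_a=p_a-w_a(\mu_{X^t}(a))$ for $a\in A^t$. **Theorem.** There is an absolute constant $K$ such that in every such situation, for every choice of the optimal primal-dual pairs, $R_T$ is integrable and $$\mathbb E(R_T)\le K\,|\mathcal A|\sqrt{nT\log(|\mathcal A|T)} .$$ -/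

import Mathlib

open MeasureTheory ProbabilityTheory

universe u₁ u₂ u₃

noncomputable section

namespace MatchTransfers

/-! ### Matching with transfers

`C` is the set of all customers, `P` the set of all providers, and `C ⊕ P` the set of all agents.
A set of agents present in the market is a `Finset (C ⊕ P)`. -/

section Market

variable {C P : Type*}

/-- A matching is a set of pairwise disjoint (customer, provider) pairs. -/
def IsMatching (X : Finset (C × P)) : Prop :=
  ∀ e ∈ X, ∀ f ∈ X, e.1 = f.1 ∨ e.2 = f.2 → e = f

open scoped Classical in
/-- The finite set of all matchings between the customers in `S` and the providers in `S`. -/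
def matchings (S : Finset (C ⊕ P)) : Finset (Finset (C × P)) :=
  (S.toLeft ×ˢ S.toRight).powerset.filter IsMatching

theorem matchings_nonempty (S : Finset (C ⊕ P)) : (matchings S).Nonempty :=
  ⟨∅, by simp [matchings, IsMatching]⟩

open scoped Classical in
/-- The partner of an agent in a matching; an unmatched agent is its own partner. -/
def partner (X : Finset (C × P)) : C ⊕ P → C ⊕ P
  | Sum.inl c => if h : ∃ p, (c, p) ∈ X then Sum.inr h.choose else Sum.inl c
  | Sum.inr p => if h : ∃ c, (c, p) ∈ X then Sum.inl h.choose else Sum.inr p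

/-- The largest total utility of a matching among the agents of `S`. -/
def maxWeight (u : C ⊕ P → C ⊕ P → ℝ) (S : Finset (C ⊕ P)) : ℝ :=
  (matchings S).sup' (matchings_nonempty S) fun X' => ∑ a ∈ S, u a (partner X' a)

/-- Subset Instability of the market outcome `(X, τ)` on the set `A` of agents: the maximum over
the subsets `S` of `A` of the largest total utility that `S` can obtain by matching among itself,
minus the total net utility of `S` under `(X, τ)`. -/
def subsetInstability (u : C ⊕ P → C ⊕ P → ℝ) (A : Finset (C ⊕ P))
    (X : Finset (C × P)) (τ : C ⊕ P → ℝ) : ℝ :=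
  A.powerset.sup' ⟨∅, Finset.empty_mem_powerset A⟩ fun S =>
    maxWeight u S - ∑ a ∈ S, (u a (partner X a) + τ a)

/-- Unstructured preferences: utilities in `[-1, 1]`, where an unmatched agent gets `0`.
(Values at two distinct agents of the same side play no role.) -/
def unstructured (C P : Type*) : Set (C ⊕ P → C ⊕ P → ℝ) :=
  {u | (∀ a, u a a = 0) ∧ ∀ a a', u a a' ∈ Set.Icc (-1 : ℝ) 1}

/-! ### The primal and the dual linear program -/

/-- Feasibility for the primal program (P) of the market with set of agents `A`. -/
def PrimalFeasible (A : Finset (C ⊕ P)) (Z : C → P → ℝ) : Prop :=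
  (∀ c ∈ A.toLeft, ∑ p ∈ A.toRight, Z c p ≤ 1) ∧
  (∀ p ∈ A.toRight, ∑ c ∈ A.toLeft, Z c p ≤ 1) ∧
  ∀ c ∈ A.toLeft, ∀ p ∈ A.toRight, 0 ≤ Z c p

/-- The objective of the primal program (P). -/
def primalObjective (u : C ⊕ P → C ⊕ P → ℝ) (A : Finset (C ⊕ P)) (Z : C → P → ℝ) : ℝ :=
  ∑ c ∈ A.toLeft, ∑ p ∈ A.toRight,
    Z c p * (u (Sum.inl c) (Sum.inr p) + u (Sum.inr p) (Sum.inl c))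

def PrimalOptimal (u : C ⊕ P → C ⊕ P → ℝ) (A : Finset (C ⊕ P)) (Z : C → P → ℝ) : Prop :=
  PrimalFeasible A Z ∧
    ∀ Z', PrimalFeasible A Z' → primalObjective u A Z' ≤ primalObjective u A Z

/-- Feasibility for the dual program (D) of the market with set of agents `A`. -/
def DualFeasible (u : C ⊕ P → C ⊕ P → ℝ) (A : Finset (C ⊕ P)) (π : C ⊕ P → ℝ) : Prop :=
  (∀ c ∈ A.toLeft, ∀ p ∈ A.toRight,
    u (Sum.inl c) (Sum.inr p) + u (Sum.inr p) (Sum.inl c) ≤ π (Sum.inl c) + π (Sum.inr p)) ∧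
  ∀ a ∈ A, 0 ≤ π a

def DualOptimal (u : C ⊕ P → C ⊕ P → ℝ) (A : Finset (C ⊕ P)) (π : C ⊕ P → ℝ) : Prop :=
  DualFeasible u A π ∧ ∀ π', DualFeasible u A π' → ∑ a ∈ A, π a ≤ ∑ a ∈ A, π' a

open scoped Classical in
/-- The 0-1 matrix of a set of pairs. -/
def indicatorMatrix (X : Finset (C × P)) (c : C) (p : P) : ℝ := if (c, p) ∈ X then 1 else 0

/-- `(X, π)` is an optimal primal-dual pair in which the primal solution is a matching. -/
def IsOptimalPair (u : C ⊕ P → C ⊕ P → ℝ) (A : Finset (C ⊕ P)) (X : Finset (C × P))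
    (π : C ⊕ P → ℝ) : Prop :=
  X ∈ matchings A ∧ PrimalOptimal u A (indicatorMatrix X) ∧ DualOptimal u A π

/-! ### The algorithm MatchUCB -/

/-- `v` is the upper confidence bound read off from the confidence set `I ⊆ [-1, 1]`: its maximum.
Should `I` be empty, any value of `[-1, 1]` may be used. -/
def IsUpperBoundOf (I : Set ℝ) (v : ℝ) : Prop :=
  v ∈ Set.Icc (-1 : ℝ) 1 ∧ (I.Nonempty → IsGreatest I v)

/-- `w` is a table of UCB utilities for the collection `conf` of confidence sets
(and an unmatched agent has utility `0`). -/
def IsUCBUtility (conf : C ⊕ P → C ⊕ P → Set ℝ) (w : C ⊕ P → C ⊕ P → ℝ) : Prop :=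
  (∀ a, w a a = 0) ∧
  ∀ (c : C) (p : P),
    IsUpperBoundOf (conf (Sum.inl c) (Sum.inr p)) (w (Sum.inl c) (Sum.inr p)) ∧
    IsUpperBoundOf (conf (Sum.inr p) (Sum.inl c)) (w (Sum.inr p) (Sum.inl c))

/-- `(X, τ)` is a possible output of ComputeMatch for the agents `A` and the confidence sets `conf`:
take the UCB utilities `w`, any optimal primal-dual pair `(X, π)` for them, and set the
transfers `τ a = π a - w a (partner X a)`. -/
def ComputeMatch (A : Finset (C ⊕ P)) (conf : C ⊕ P → C ⊕ P → Set ℝ)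
    (X : Finset (C × P)) (τ : C ⊕ P → ℝ) : Prop :=
  ∃ (w : C ⊕ P → C ⊕ P → ℝ) (π : C ⊕ P → ℝ),
    IsUCBUtility conf w ∧ IsOptimalPair w A X π ∧ ∀ a ∈ A, τ a = π a - w a (partner X a)

open scoped Classical in
/-- The rounds before round `t` in which the agent `a` was matched to `a'` (for `a`, `a'` on
opposite sides), when `X s` is the matching of round `s`. -/
def matchedRounds (X : ℕ → Finset (C × P)) (t : ℕ) (a a' : C ⊕ P) : Finset ℕ :=
  (Finset.range t).filter fun s => partner (X s) a = a'

/-- The mean of the feedback `y s a` that `a` gave in the rounds before `t` in which it was matched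
to `a'` (only used when there is such a round). -/
def empiricalMean (X : ℕ → Finset (C × P)) (y : ℕ → C ⊕ P → ℝ) (t : ℕ) (a a' : C ⊕ P) : ℝ :=
  (∑ s ∈ matchedRounds X t a a', y s a) / ((matchedRounds X t a a').card : ℝ)

/-- The confidence set of MatchUCB, run with horizon `T`, for the utility of `a` when matched to
`a'`, at the start of round `t`. -/
def confidenceSet [Fintype C] [Fintype P] (T : ℕ) (X : ℕ → Finset (C × P)) (y : ℕ → C ⊕ P → ℝ)
    (t : ℕ) (a a' : C ⊕ P) : Set ℝ :=
  if (matchedRounds X t a a').card = 0 then Set.Icc (-1) 1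
  else
    Set.Icc
      (empiricalMean X y t a a' - 8 * √(Real.log ((Fintype.card (C ⊕ P) : ℝ) * (T : ℝ)) /
        ((matchedRounds X t a a').card : ℝ)))
      (empiricalMean X y t a a' + 8 * √(Real.log ((Fintype.card (C ⊕ P) : ℝ) * (T : ℝ)) /
        ((matchedRounds X t a a').card : ℝ)))
    ∩ Set.Icc (-1) 1

end Market

/-! ### The bandit model

Rounds are numbered `0, 1, …, T - 1`. The σ-algebra `ℱ t` is the information available in round
`t` before the feedback of that round: it determines the noise of the earlier rounds, and it may
contain further randomness (of the arrivals, or of the choice among optimal primal-dual pairs). -/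

section Bandit

variable {C P Ω : Type*} [mΩ : MeasurableSpace Ω]

/-- The noise variables `ε t a` are independent and 1-subgaussian, and the noise of round `t` is
independent of the information `ℱ t` available when the outcome of round `t` is chosen. -/
structure IsNoise (μ : Measure Ω) (ℱ : Filtration ℕ mΩ) (ε : ℕ → C ⊕ P → Ω → ℝ) : Prop where
  measurable : ∀ t a, Measurable (ε t a)
  subgaussian : ∀ t a, HasSubgaussianMGF (ε t a) 1 μ
  indep : iIndepFun (fun i : ℕ × (C ⊕ P) => ε i.1 i.2) μ
  observed : ∀ s t a, s < t → Measurable[ℱ t] (ε s a)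
  nonanticipating : ∀ t, Indep (⨆ a, MeasurableSpace.comap (ε t a) inferInstance) (ℱ t) μ

/-- The noisy utility that is observed for agent `a` in round `t`. -/
def feedback (u : C ⊕ P → C ⊕ P → ℝ) (ε : ℕ → C ⊕ P → Ω → ℝ) (X : ℕ → Ω → Finset (C × P))
    (ω : Ω) (t : ℕ) (a : C ⊕ P) : ℝ :=
  u a (partner (X t ω) a) + ε t a ω

/-- `(X t, τ t)`, for `t < T`, are the outcomes selected by MatchUCB with horizon `T` when the
agents `A t` arrive in round `t`: the arrivals and the outcome of round `t` depend on the
information `ℱ t` only, and the outcome is an output of ComputeMatch for the confidence sets built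
from the feedback of the earlier rounds. -/
structure IsMatchUCB [Fintype C] [Fintype P] (ℱ : Filtration ℕ mΩ) (u : C ⊕ P → C ⊕ P → ℝ)
    (ε : ℕ → C ⊕ P → Ω → ℝ) (T : ℕ) (A : ℕ → Ω → Finset (C ⊕ P)) (X : ℕ → Ω → Finset (C × P))
    (τ : ℕ → Ω → C ⊕ P → ℝ) : Prop where
  measurable_arrivals : ∀ t < T, ∀ S, MeasurableSet[ℱ t] {ω | A t ω = S}
  measurable_matching : ∀ t < T, ∀ S, MeasurableSet[ℱ t] {ω | X t ω = S}
  measurable_transfer : ∀ t < T, ∀ a, Measurable[ℱ t] fun ω => τ t ω a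
  computeMatch : ∀ t < T, ∀ ω,
    ComputeMatch (A t ω) (confidenceSet T (fun s => X s ω) (feedback u ε X ω) t) (X t ω) (τ t ω)

/-- The regret: the cumulative Subset Instability over the rounds `0, …, T - 1`. -/
def regret (u : C ⊕ P → C ⊕ P → ℝ) (T : ℕ) (A : ℕ → Ω → Finset (C ⊕ P))
    (X : ℕ → Ω → Finset (C × P)) (τ : ℕ → Ω → C ⊕ P → ℝ) (ω : Ω) : ℝ :=
  ∑ t ∈ Finset.range T, subsetInstability u (A t ω) (X t ω) (τ t ω)

end Bandit

end MatchTransfers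

end

/-! The proof combines optimism with LP duality. If every UCB utility `w` dominates the true `u`,
then a coalition `S` matched within itself earns at most its total price, because the prices are
dual feasible for `w`. Under the outcome, agent `a` has net utility equal to its price minus the gap
`w - u` at its partner. Hence the instability is at most the sum of these gaps over the matched
agents (`subsetInstability_le_sum_sub`).

Write `M = |A| T` and `L = log M`. When the confidence sets hold, the gap at a pair matched `N`
times before is at most a constant times `√L (√(N+1) - √N)`. The regret therefore telescopes to `√L`
times the sum of `√N_T` over ordered pairs (`subsetInstability_le_potential_sub`). Cauchy–Schwarz,
with total count at most `nT` over at most `|A|²` pairs, bounds that sum by `|A| √(nT)`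
(`matchPotential_le`).

The number of observations of a pair is random and depends on the past. An exponential
supermartingale (`lintegral_prod_exp_le_one`) handles each possible count `k`, and a union bound
over pairs, rounds and counts gives failure probability at most `2/M`. Multiplied by the crude bound
`3 √n M` on the regret, this costs only `6 √n`. -/

namespace MatchTransfers

open scoped Classical

/-! ### Matchings, dual prices and deterministic bounds on the instability. -/

section Market

variable {C P : Type*}

theorem mem_of_partner_inl {X : Finset (C × P)} {c : C} {p : P}
    (h : partner X (Sum.inl c) = Sum.inr p) : (c, p) ∈ X := by
  simp only [partner] at h
  split_ifs at h with h'
  · exact Sum.inr.inj h ▸ h'.choose_spec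

theorem mem_of_partner_inr {X : Finset (C × P)} {c : C} {p : P}
    (h : partner X (Sum.inr p) = Sum.inl c) : (c, p) ∈ X := by
  simp only [partner] at h
  split_ifs at h with h'
  · exact Sum.inl.inj h ▸ h'.choose_spec

theorem partner_inl_of_mem {X : Finset (C × P)} (hX : IsMatching X) {c : C} {p : P}
    (h : (c, p) ∈ X) : partner X (Sum.inl c) = Sum.inr p := by
  have h' : ∃ p, (c, p) ∈ X := ⟨p, h⟩
  simp only [partner]
  rw [dif_pos h']
  exact congrArg Sum.inr (Prod.ext_iff.1 (hX _ h'.choose_spec _ h (Or.inl rfl))).2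

theorem partner_inr_of_mem {X : Finset (C × P)} (hX : IsMatching X) {c : C} {p : P}
    (h : (c, p) ∈ X) : partner X (Sum.inr p) = Sum.inl c := by
  have h' : ∃ c, (c, p) ∈ X := ⟨c, h⟩
  simp only [partner]
  rw [dif_pos h']
  exact congrArg Sum.inl (Prod.ext_iff.1 (hX _ h'.choose_spec _ h (Or.inr rfl))).1

theorem partner_inl_cases (X : Finset (C × P)) (c : C) :
    partner X (Sum.inl c) = Sum.inl c ∨ ∃ p, partner X (Sum.inl c) = Sum.inr p := by
  simp only [partner]
  split_ifs with h
  · exact Or.inr ⟨_, rfl⟩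
  · exact Or.inl rfl

theorem partner_inr_cases (X : Finset (C × P)) (p : P) :
    partner X (Sum.inr p) = Sum.inr p ∨ ∃ c, partner X (Sum.inr p) = Sum.inl c := by
  simp only [partner]
  split_ifs with h
  · exact Or.inr ⟨_, rfl⟩
  · exact Or.inl rfl

theorem isMatching_of_mem_matchings {S : Finset (C ⊕ P)} {X : Finset (C × P)}
    (hX : X ∈ matchings S) : IsMatching X := (Finset.mem_filter.1 hX).2

theorem mem_of_mem_matchings {S : Finset (C ⊕ P)} {X : Finset (C × P)}
    (hX : X ∈ matchings S) {e : C × P} (he : e ∈ X) : Sum.inl e.1 ∈ S ∧ Sum.inr e.2 ∈ S := by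
  have := Finset.mem_product.1 (Finset.mem_powerset.1 (Finset.mem_filter.1 hX).1 he)
  simpa using this

/-- Only agents present in the market can be matched. -/
theorem mem_of_partner_ne {S : Finset (C ⊕ P)} {X : Finset (C × P)} (hX : X ∈ matchings S)
    {a : C ⊕ P} (h : partner X a ≠ a) : a ∈ S := by
  rcases a with c | p
  · rcases partner_inl_cases X c with h' | ⟨p, h'⟩
    · exact absurd h' h
    · exact (mem_of_mem_matchings hX (mem_of_partner_inl h')).1
  · rcases partner_inr_cases X p with h' | ⟨c, h'⟩
    · exact absurd h' h
    · exact (mem_of_mem_matchings hX (mem_of_partner_inr h')).2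

/-- A matching among `S` cannot pay more than the dual prices of `S`. -/
theorem sum_partner_le_sum_dual {w : C ⊕ P → C ⊕ P → ℝ} {A S : Finset (C ⊕ P)}
    {X : Finset (C × P)} {π : C ⊕ P → ℝ} (hw : ∀ a, w a a = 0) (hπ : DualFeasible w A π)
    (hS : S ⊆ A) (hX : X ∈ matchings S) :
    ∑ a ∈ S, w a (partner X a) ≤ ∑ a ∈ S, π a := by
  have hM := isMatching_of_mem_matchings hX
  -- The slack of a single matched agent may be negative. It is nonnegative for an unmatched agent,
  -- and for each matched pair in total; `S` splits into these.
  set f : C ⊕ P → ℝ := fun a => π a - w a (partner X a) with hf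
  suffices h : 0 ≤ ∑ a ∈ S, f a by
    rw [hf, Finset.sum_sub_distrib] at h
    linarith
  have hself : ∀ a ∈ S, partner X a = a → 0 ≤ f a := by
    intro a ha h
    simp only [hf, h, hw, sub_zero]
    exact hπ.2 a (hS ha)
  have hl : ∑ e ∈ X, f (Sum.inl e.1) ≤ ∑ c ∈ S.toLeft, f (Sum.inl c) := by
    rw [← Finset.sum_image (s := X) (g := Prod.fst) (f := fun c => f (Sum.inl c))
      (fun e he e' he' h => hM e he e' he' (Or.inl h))]
    refine Finset.sum_le_sum_of_subset_of_nonneg ?_ ?_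
    · intro c hc
      obtain ⟨e, he, rfl⟩ := Finset.mem_image.1 hc
      simpa using (mem_of_mem_matchings hX he).1
    · intro c hc hc'
      refine hself _ (by simpa using hc) ((partner_inl_cases X c).resolve_right ?_)
      rintro ⟨p, hp⟩
      exact hc' (Finset.mem_image.2 ⟨(c, p), mem_of_partner_inl hp, rfl⟩)
  have hr : ∑ e ∈ X, f (Sum.inr e.2) ≤ ∑ p ∈ S.toRight, f (Sum.inr p) := by
    rw [← Finset.sum_image (s := X) (g := Prod.snd) (f := fun p => f (Sum.inr p))
      (fun e he e' he' h => hM e he e' he' (Or.inr h))]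
    refine Finset.sum_le_sum_of_subset_of_nonneg ?_ ?_
    · intro p hp
      obtain ⟨e, he, rfl⟩ := Finset.mem_image.1 hp
      simpa using (mem_of_mem_matchings hX he).2
    · intro p hp hp'
      refine hself _ (by simpa using hp) ((partner_inr_cases X p).resolve_right ?_)
      rintro ⟨c, hc⟩
      exact hp' (Finset.mem_image.2 ⟨(c, p), mem_of_partner_inr hc, rfl⟩)
  have hpair : 0 ≤ ∑ e ∈ X, (f (Sum.inl e.1) + f (Sum.inr e.2)) := by
    refine Finset.sum_nonneg fun e he => ?_
    obtain ⟨h1, h2⟩ := mem_of_mem_matchings hX he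
    have := hπ.1 e.1 (by simpa using hS h1) e.2 (by simpa using hS h2)
    simp only [hf, partner_inl_of_mem hM he, partner_inr_of_mem hM he]
    linarith
  have hsplit : ∑ a ∈ S, f a
      = ∑ c ∈ S.toLeft, f (Sum.inl c) + ∑ p ∈ S.toRight, f (Sum.inr p) := by
    conv_lhs => rw [← Finset.toLeft_disjSum_toRight (u := S)]
    rw [Finset.sum_disjSum]
  rw [Finset.sum_add_distrib] at hpair
  linarith

theorem le_partner_of_le {u w : C ⊕ P → C ⊕ P → ℝ} (hu : ∀ a, u a a = 0) (hw : ∀ a, w a a = 0)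
    (h : ∀ (c : C) (p : P), u (Sum.inl c) (Sum.inr p) ≤ w (Sum.inl c) (Sum.inr p) ∧
      u (Sum.inr p) (Sum.inl c) ≤ w (Sum.inr p) (Sum.inl c))
    (X : Finset (C × P)) (a : C ⊕ P) : u a (partner X a) ≤ w a (partner X a) := by
  rcases a with c | p
  · rcases partner_inl_cases X c with h' | ⟨p, h'⟩ <;> rw [h']
    · rw [hu, hw]
    · exact (h c p).1
  · rcases partner_inr_cases X p with h' | ⟨c, h'⟩ <;> rw [h']
    · rw [hu, hw]
    · exact (h c p).2

theorem subsetInstability_nonneg (u : C ⊕ P → C ⊕ P → ℝ) (A : Finset (C ⊕ P))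
    (X : Finset (C × P)) (τ : C ⊕ P → ℝ) : 0 ≤ subsetInstability u A X τ := by
  -- The empty coalition contributes `0`.
  refine le_trans ?_ (Finset.le_sup' _ (Finset.empty_mem_powerset A))
  rw [Finset.sum_empty, sub_zero, maxWeight]
  simp

/-- If the utilities `w` are optimistic, the instability is at most the total optimism. -/
theorem subsetInstability_le_sum_sub {u w : C ⊕ P → C ⊕ P → ℝ} {A : Finset (C ⊕ P)}
    {X : Finset (C × P)} {π τ : C ⊕ P → ℝ} (hu : ∀ a, u a a = 0) (hw : ∀ a, w a a = 0)
    (h : ∀ (c : C) (p : P), u (Sum.inl c) (Sum.inr p) ≤ w (Sum.inl c) (Sum.inr p) ∧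
      u (Sum.inr p) (Sum.inl c) ≤ w (Sum.inr p) (Sum.inl c))
    (hπ : DualFeasible w A π) (hτ : ∀ a ∈ A, τ a = π a - w a (partner X a)) :
    subsetInstability u A X τ ≤ ∑ a ∈ A, (w a (partner X a) - u a (partner X a)) := by
  refine Finset.sup'_le _ _ fun S hS => ?_
  have hSA := Finset.mem_powerset.1 hS
  have hmax : maxWeight u S ≤ ∑ a ∈ S, π a :=
    Finset.sup'_le _ _ fun X' hX' =>
      (Finset.sum_le_sum fun a _ => le_partner_of_le hu hw h X' a).trans
        (sum_partner_le_sum_dual hw hπ hSA hX')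
  -- The transfers turn net utility into price minus optimism, so the prices cancel against `hmax`.
  have h1 : ∑ a ∈ S, (u a (partner X a) + τ a)
      = ∑ a ∈ S, π a - ∑ a ∈ S, (w a (partner X a) - u a (partner X a)) := by
    rw [← Finset.sum_sub_distrib]
    refine Finset.sum_congr rfl fun a ha => ?_
    rw [hτ a (hSA ha)]
    ring
  have h2 : ∑ a ∈ S, (w a (partner X a) - u a (partner X a))
      ≤ ∑ a ∈ A, (w a (partner X a) - u a (partner X a)) :=
    Finset.sum_le_sum_of_subset_of_nonneg hSA fun a _ _ =>
      sub_nonneg.2 (le_partner_of_le hu hw h X a)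
  linarith

theorem partner_le_one {w : C ⊕ P → C ⊕ P → ℝ} {conf : C ⊕ P → C ⊕ P → Set ℝ}
    (hw : IsUCBUtility conf w) (X : Finset (C × P)) (a : C ⊕ P) : w a (partner X a) ≤ 1 := by
  rcases a with c | p
  · rcases partner_inl_cases X c with h' | ⟨p, h'⟩ <;> rw [h']
    · rw [hw.1]; norm_num
    · exact (hw.2 c p).1.1.2
  · rcases partner_inr_cases X p with h' | ⟨c, h'⟩ <;> rw [h']
    · rw [hw.1]; norm_num
    · exact (hw.2 c p).2.1.2

/-- The instability of any output of ComputeMatch is bounded, whatever the confidence sets. -/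
theorem subsetInstability_le_card {u : C ⊕ P → C ⊕ P → ℝ} {A : Finset (C ⊕ P)}
    {X : Finset (C × P)} {τ : C ⊕ P → ℝ} {conf : C ⊕ P → C ⊕ P → Set ℝ}
    (hu : u ∈ unstructured C P) (h : ComputeMatch A conf X τ) :
    subsetInstability u A X τ ≤ 3 * (A.card : ℝ) := by
  obtain ⟨w, π, hw, ⟨-, -, hπ⟩, hτ⟩ := h
  refine Finset.sup'_le _ _ fun S hS => ?_
  have hSA := Finset.mem_powerset.1 hS
  have hcard : (S.card : ℝ) ≤ A.card := by exact_mod_cast Finset.card_le_card hSA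
  have hmax : maxWeight u S ≤ S.card := by
    refine Finset.sup'_le _ _ fun X' _ => ?_
    simpa using Finset.sum_le_sum fun a (_ : a ∈ S) => (hu.2 a (partner X' a)).2
  -- Per agent: `u ≥ -1`, the price is nonnegative, and `w ≤ 1`.
  have h1 : -(2 * (S.card : ℝ)) ≤ ∑ a ∈ S, (u a (partner X a) + τ a) := by
    have : ∑ a ∈ S, (-2 : ℝ) ≤ ∑ a ∈ S, (u a (partner X a) + τ a) := by
      refine Finset.sum_le_sum fun a ha => ?_
      rw [hτ a (hSA ha)]
      have := (hu.2 a (partner X a)).1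
      have := partner_le_one hw X a
      have := hπ.1.2 a (hSA ha)
      linarith
    simp only [Finset.sum_const, nsmul_eq_mul] at this
    linarith
  linarith

theorem subsetInstability_eq_zero [Subsingleton (C ⊕ P)] {u : C ⊕ P → C ⊕ P → ℝ}
    {A : Finset (C ⊕ P)} {X : Finset (C × P)} {τ : C ⊕ P → ℝ} {conf : C ⊕ P → C ⊕ P → Set ℝ}
    (hu : u ∈ unstructured C P) (h : ComputeMatch A conf X τ) :
    subsetInstability u A X τ = 0 := by
  obtain ⟨w, π, hw, ⟨-, -, hπ⟩, hτ⟩ := h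
  refine le_antisymm ?_ (subsetInstability_nonneg u A X τ)
  refine (subsetInstability_le_sum_sub hu.1 hw.1 (fun c p => ?_) hπ.1 hτ).trans_eq ?_
  · exact absurd (Subsingleton.elim (Sum.inl c : C ⊕ P) (Sum.inr p)) (by simp)
  · refine Finset.sum_eq_zero fun a _ => ?_
    rw [Subsingleton.elim (partner X a) a, hu.1, hw.1, sub_zero]

end Market

/-! ### Concentration for noise sampled on predictable events. -/

section Concentration

variable {Ω : Type*} [mΩ : MeasurableSpace Ω] {μ : Measure Ω}

/-- The exponential supermartingale of subgaussian noise observed on predictable events. -/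
theorem lintegral_prod_exp_le_one [IsProbabilityMeasure μ] {ℱ : Filtration ℕ mΩ}
    {ξ : ℕ → Ω → ℝ} {E : ℕ → Set Ω} {T : ℕ}
    (hsub : ∀ s, HasSubgaussianMGF (ξ s) 1 μ) (hmeas : ∀ s, Measurable (ξ s))
    (hobs : ∀ s t, s < t → Measurable[ℱ t] (ξ s))
    (hind : ∀ t, Indep (MeasurableSpace.comap (ξ t) inferInstance) (ℱ t) μ)
    (hE : ∀ s < T, MeasurableSet[ℱ s] (E s)) (l : ℝ) {t : ℕ} (ht : t ≤ T) :
    ∫⁻ ω, ∏ s ∈ Finset.range t,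
      (if ω ∈ E s then ENNReal.ofReal (Real.exp (l * ξ s ω - l ^ 2 / 2)) else 1) ∂μ ≤ 1 := by
  induction t with
  | zero => simp
  | succ t ih =>
    have htT : t < T := ht
    set M : Ω → ENNReal := fun ω => ∏ s ∈ Finset.range t,
      (if ω ∈ E s then ENNReal.ofReal (Real.exp (l * ξ s ω - l ^ 2 / 2)) else 1) with hM
    have hMm : Measurable[ℱ t] M := by
      refine Finset.measurable_fun_prod _ fun s hs => ?_
      have hst := Finset.mem_range.1 hs
      refine Measurable.ite (ℱ.mono hst.le _ (hE s (hst.trans htT))) ?_ measurable_const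
      exact ((((hobs s t hst).const_mul l).sub_const _).exp).ennreal_ofReal
    set g : ℝ → ENNReal := fun x => ENNReal.ofReal (Real.exp (l * x - l ^ 2 / 2)) with hg
    have hgm : Measurable g := by fun_prop
    have hone : ∫⁻ ω, g (ξ t ω) ∂μ ≤ 1 := by
      have hint : Integrable (fun ω => Real.exp (l * ξ t ω - l ^ 2 / 2)) μ := by
        simp_rw [Real.exp_sub, div_eq_mul_inv]
        exact ((hsub t).integrable_exp_mul l).mul_const _
      rw [hg, ← ofReal_integral_eq_lintegral_ofReal hint
        (Filter.Eventually.of_forall fun ω => (Real.exp_pos _).le)]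
      rw [← ENNReal.ofReal_one]
      refine ENNReal.ofReal_le_ofReal ?_
      simp_rw [Real.exp_sub, div_eq_mul_inv]
      rw [integral_mul_const, ← div_eq_mul_inv, div_le_one (Real.exp_pos _)]
      simpa [mgf, div_eq_mul_inv] using (hsub t).mgf_le l
    have hEt := hE t htT
    -- Whether round `t` is sampled is known in `ℱ t`. On `E t` the new factor is independent of the
    -- past and has mean at most `1`; off `E t` nothing changes.
    have hsplit : ∀ ω, ∏ s ∈ Finset.range (t + 1),
        (if ω ∈ E s then ENNReal.ofReal (Real.exp (l * ξ s ω - l ^ 2 / 2)) else 1)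
        = (E t).indicator M ω * g (ξ t ω) + (E t)ᶜ.indicator M ω := by
      intro ω
      rw [Finset.prod_range_succ]
      by_cases h : ω ∈ E t <;> simp [h, hM, hg]
    have hle := ℱ.le t
    have hIm : Measurable[ℱ t] ((E t).indicator M) := hMm.indicator hEt
    have hindf : IndepFun ((E t).indicator M) (fun ω => g (ξ t ω)) μ := by
      rw [IndepFun_iff_Indep]
      refine indep_of_indep_of_le_left (indep_of_indep_of_le_right (hind t).symm ?_) ?_
      · rintro _ ⟨s, hs, rfl⟩
        exact ⟨g ⁻¹' s, hgm hs, rfl⟩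
      · exact hIm.comap_le
    simp_rw [hsplit]
    have hprod : ∫⁻ ω, (E t).indicator M ω * g (ξ t ω) ∂μ
        = (∫⁻ ω, (E t).indicator M ω ∂μ) * ∫⁻ ω, g (ξ t ω) ∂μ :=
      lintegral_mul_eq_lintegral_mul_lintegral_of_indepFun (hIm.mono hle le_rfl)
        (hgm.comp (hmeas t)) hindf
    rw [lintegral_add_right _ ((hMm.mono hle le_rfl).indicator (hle _ hEt).compl), hprod]
    calc _ ≤ (∫⁻ ω, (E t).indicator M ω ∂μ) * 1 + ∫⁻ ω, (E t)ᶜ.indicator M ω ∂μ := by gcongr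
      _ = ∫⁻ ω, M ω ∂μ := by
        rw [mul_one, lintegral_indicator (hle _ hEt), lintegral_indicator (hle _ hEt).compl,
          lintegral_add_compl _ (hle _ hEt)]
      _ ≤ 1 := ih htT.le

/-- Upper tail of a sum of `k` subgaussian noise terms observed on predictable events. -/
theorem measure_sum_gt_le [IsProbabilityMeasure μ] {ℱ : Filtration ℕ mΩ}
    {ξ : ℕ → Ω → ℝ} {E : ℕ → Set Ω} {T : ℕ}
    (hsub : ∀ s, HasSubgaussianMGF (ξ s) 1 μ) (hmeas : ∀ s, Measurable (ξ s))
    (hobs : ∀ s t, s < t → Measurable[ℱ t] (ξ s))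
    (hind : ∀ t, Indep (MeasurableSpace.comap (ξ t) inferInstance) (ℱ t) μ)
    (hE : ∀ s < T, MeasurableSet[ℱ s] (E s)) {t : ℕ} (ht : t ≤ T) {k : ℕ} (hk : k ≠ 0)
    {L : ℝ} (hL : 0 ≤ L) :
    μ {ω | ((Finset.range t).filter fun s => ω ∈ E s).card = k ∧
        8 * √(L * k) < ∑ s ∈ (Finset.range t).filter fun s => ω ∈ E s, ξ s ω}
      ≤ ENNReal.ofReal (Real.exp (-(32 * L))) := by
  have hk' : (0 : ℝ) < k := by exact_mod_cast Nat.pos_of_ne_zero hk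
  -- This `l` maximizes `l · 8√(Lk) - k l²/2`, with value `64 L - 32 L = 32 L`.
  set l : ℝ := 8 * √(L / k) with hl
  set M : Ω → ENNReal := fun ω => ∏ s ∈ Finset.range t,
      (if ω ∈ E s then ENNReal.ofReal (Real.exp (l * ξ s ω - l ^ 2 / 2)) else 1) with hM
  have hMm : Measurable M := by
    refine Finset.measurable_fun_prod _ fun s hs => ?_
    have hst := Finset.mem_range.1 hs
    refine Measurable.ite (ℱ.le s _ (hE s (hst.trans_le ht))) ?_ measurable_const
    exact ((((hmeas s).const_mul l).sub_const _).exp).ennreal_ofReal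
  have hmarkov := mul_meas_ge_le_lintegral (μ := μ) hMm (ENNReal.ofReal (Real.exp (32 * L)))
  have hle1 := lintegral_prod_exp_le_one hsub hmeas hobs hind hE l ht
  have hsubset : {ω | ((Finset.range t).filter fun s => ω ∈ E s).card = k ∧
        8 * √(L * k) < ∑ s ∈ (Finset.range t).filter fun s => ω ∈ E s, ξ s ω}
      ⊆ {ω | ENNReal.ofReal (Real.exp (32 * L)) ≤ M ω} := by
    rintro ω ⟨hc, hD⟩
    have hMω : M ω = ENNReal.ofReal (Real.exp
        (l * (∑ s ∈ (Finset.range t).filter fun s => ω ∈ E s, ξ s ω) - k * (l ^ 2 / 2))) := by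
      rw [hM]
      dsimp only
      rw [← Finset.prod_filter, ← ENNReal.ofReal_prod_of_nonneg fun _ _ => (Real.exp_pos _).le,
        ← Real.exp_sum, Finset.sum_sub_distrib, ← Finset.mul_sum, Finset.sum_const, hc,
        nsmul_eq_mul]
    rw [Set.mem_ofPred_eq, hMω]
    refine ENNReal.ofReal_le_ofReal (Real.exp_le_exp.2 ?_)
    have h1 : l ^ 2 * k = 64 * L := by
      rw [hl, mul_pow, Real.sq_sqrt (by positivity)]
      field_simp
      ring
    have h2 : l * (8 * √(L * k)) = 64 * L := by
      have : √(L / k) * √(L * k) = L := by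
        rw [← Real.sqrt_mul (by positivity), show L / k * (L * k) = L * L by field_simp,
          Real.sqrt_mul_self hL]
      rw [hl]
      linear_combination 64 * this
    have h3 := mul_le_mul_of_nonneg_left hD.le (show 0 ≤ l by positivity)
    linarith
  refine (measure_mono hsubset).trans ?_
  rw [Real.exp_neg, ENNReal.ofReal_inv_of_pos (Real.exp_pos _), ← one_div,
    ENNReal.le_div_iff_mul_le (Or.inl (by simp [Real.exp_pos])) (Or.inl (by simp)), mul_comm]
  exact hmarkov.trans hle1

end Concentration

/-! ### Validity and width of the confidence sets, and the counting potential. -/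

section Confidence

variable {C P : Type*}

/-- In the first `T` rounds, the accumulated noise of every ordered pair of agents stays within
the radius of its confidence set. -/
def NoiseControlled (L : ℝ) (T : ℕ) (x : ℕ → Finset (C × P)) (e : ℕ → C ⊕ P → ℝ) : Prop :=
  ∀ t < T, ∀ a a', (matchedRounds x t a a').card ≠ 0 →
    |∑ s ∈ matchedRounds x t a a', e s a| ≤ 8 * √(L * (matchedRounds x t a a').card)

theorem empiricalMean_eq {u : C ⊕ P → C ⊕ P → ℝ} {x : ℕ → Finset (C × P)} {e : ℕ → C ⊕ P → ℝ}
    {t : ℕ} {a a' : C ⊕ P} (h : (matchedRounds x t a a').card ≠ 0) :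
    empiricalMean x (fun s b => u b (partner (x s) b) + e s b) t a a'
      = u a a' + (∑ s ∈ matchedRounds x t a a', e s a) / (matchedRounds x t a a').card := by
  have h' : ((matchedRounds x t a a').card : ℝ) ≠ 0 := by exact_mod_cast h
  have h1 : ∑ s ∈ matchedRounds x t a a', u a (partner (x s) a)
      = (matchedRounds x t a a').card * u a a' := by
    rw [← nsmul_eq_mul, ← Finset.sum_const]
    exact Finset.sum_congr rfl fun s hs => by rw [(Finset.mem_filter.1 hs).2]
  rw [empiricalMean, Finset.sum_add_distrib, h1]
  field_simp

/-- The empirical mean misses `u a a'` by the average noise, and dividing the bound `8√(LN)` on its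
sum by `N` gives the radius `8√(L/N)`. -/
theorem mem_confidenceSet [Fintype C] [Fintype P] {u : C ⊕ P → C ⊕ P → ℝ}
    (hu : u ∈ unstructured C P) {x : ℕ → Finset (C × P)} {e : ℕ → C ⊕ P → ℝ} {T t : ℕ}
    (hL : 0 ≤ Real.log ((Fintype.card (C ⊕ P) : ℝ) * (T : ℝ)))
    (h : NoiseControlled (Real.log ((Fintype.card (C ⊕ P) : ℝ) * (T : ℝ))) T x e) (ht : t < T)
    (a a' : C ⊕ P) :
    u a a' ∈ confidenceSet T x (fun s b => u b (partner (x s) b) + e s b) t a a' := by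
  unfold confidenceSet
  split_ifs with h0
  · exact hu.2 a a'
  · refine ⟨?_, hu.2 a a'⟩
    rw [empiricalMean_eq h0]
    have hb := h t ht a a' h0
    set N : ℝ := ((matchedRounds x t a a').card : ℝ)
    set L := Real.log ((Fintype.card (C ⊕ P) : ℝ) * (T : ℝ))
    set D := ∑ s ∈ matchedRounds x t a a', e s a
    have hN : 0 < N := by
      simp only [N]
      exact_mod_cast Nat.pos_of_ne_zero h0
    have hr : √(L * N) / N = √(L / N) := by
      have : L / N = L * N / N ^ 2 := by field_simp
      rw [this, Real.sqrt_div (by positivity), Real.sqrt_sq hN.le]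
    have hd : |D / N| ≤ 8 * √(L / N) := by
      rw [abs_div, abs_of_pos hN, ← hr, ← mul_div_assoc]
      gcongr
    have := abs_le.1 hd
    constructor <;> linarith

/-- The width of a confidence set is controlled by the increment of the square root of the
number of observations. -/
theorem sub_le_of_mem_confidenceSet [Fintype C] [Fintype P] {T t : ℕ} {x : ℕ → Finset (C × P)}
    {y : ℕ → C ⊕ P → ℝ} {a a' : C ⊕ P} {v v' : ℝ}
    (hL : 1 / 4 ≤ Real.log ((Fintype.card (C ⊕ P) : ℝ) * (T : ℝ)))
    (hv : v ∈ confidenceSet T x y t a a') (hv' : v' ∈ confidenceSet T x y t a a') :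
    v - v' ≤ 64 * √(Real.log ((Fintype.card (C ⊕ P) : ℝ) * (T : ℝ))) *
      (√((matchedRounds x t a a').card + 1 : ℝ) - √((matchedRounds x t a a').card : ℝ)) := by
  unfold confidenceSet at hv hv'
  -- Needed for a pair never matched: the width `2` of `[-1, 1]` must be at most `64 √L`.
  have hL2 : 1 / 2 ≤ √(Real.log ((Fintype.card (C ⊕ P) : ℝ) * (T : ℝ))) :=
    Real.le_sqrt_of_sq_le (by linarith)
  split_ifs at hv hv' with h0
  · rw [h0]
    have := hv.2
    have := hv'.1
    simp only [Nat.cast_zero, zero_add, Real.sqrt_one, Real.sqrt_zero, sub_zero, mul_one]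
    linarith
  · have h1 := hv.1.2
    have h2 := hv'.1.1
    set N : ℝ := ((matchedRounds x t a a').card : ℝ)
    set L := Real.log ((Fintype.card (C ⊕ P) : ℝ) * (T : ℝ))
    have hN : 1 ≤ N := by
      simp only [N]
      exact_mod_cast Nat.pos_of_ne_zero h0
    have hs : 0 < √N := Real.sqrt_pos.2 (by linarith)
    have hs' : √(N + 1) ≤ 2 * √N := by
      rw [show (2 : ℝ) * √N = √(4 * N) by
        rw [Real.sqrt_mul (by norm_num), show (4 : ℝ) = 2 ^ 2 by norm_num,
          Real.sqrt_sq (by norm_num)]]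
      exact Real.sqrt_le_sqrt (by linarith)
    have hsq : √(N + 1) ^ 2 - √N ^ 2 = 1 := by
      rw [Real.sq_sqrt (by linarith), Real.sq_sqrt (by linarith)]
      ring
    -- The increment is `1/(√(N+1) + √N)`, at least `1/(3√N)` by `hs'`. With the full width
    -- `16√(L/N)` this yields the constant `64`.
    have hinc : 1 / √N ≤ 4 * (√(N + 1) - √N) := by
      have hd : 0 ≤ √(N + 1) - √N := sub_nonneg.2 (Real.sqrt_le_sqrt (by linarith))
      rw [div_le_iff₀ hs]
      nlinarith
    have : √(L / N) ≤ √L * (4 * (√(N + 1) - √N)) := by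
      rw [Real.sqrt_div (by linarith), div_eq_mul_one_div]
      exact mul_le_mul_of_nonneg_left hinc (Real.sqrt_nonneg _)
    linarith

theorem card_matchedRounds_succ (x : ℕ → Finset (C × P)) (t : ℕ) (a a' : C ⊕ P) :
    (matchedRounds x (t + 1) a a').card
      = (matchedRounds x t a a').card + if partner (x t) a = a' then 1 else 0 := by
  rw [matchedRounds, matchedRounds, Finset.range_add_one, Finset.filter_insert]
  split_ifs with h
  · rw [Finset.card_insert_of_notMem (by simp)]
  · simp

theorem isUpperBoundOf_partner {w : C ⊕ P → C ⊕ P → ℝ} {conf : C ⊕ P → C ⊕ P → Set ℝ}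
    (hw : IsUCBUtility conf w) {X : Finset (C × P)} {a : C ⊕ P} (h : partner X a ≠ a) :
    IsUpperBoundOf (conf a (partner X a)) (w a (partner X a)) := by
  rcases a with c | p
  · obtain ⟨p, h'⟩ := (partner_inl_cases X c).resolve_left h
    rw [h']
    exact (hw.2 c p).1
  · obtain ⟨c, h'⟩ := (partner_inr_cases X p).resolve_left h
    rw [h']
    exact (hw.2 c p).2

/-- The potential `∑ √N_t(a, a')` over ordered pairs of distinct agents, where `N_t(a, a')` is the
number of rounds before `t` in which `a` was matched to `a'`. -/
noncomputable def matchPotential [Fintype C] [Fintype P] (x : ℕ → Finset (C × P)) (t : ℕ) : ℝ :=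
  ∑ e ∈ (Finset.univ : Finset (C ⊕ P)).offDiag, √((matchedRounds x t e.1 e.2).card : ℝ)

/-- Only gaps at matched pairs matter, and these are the pairs whose counts grow by one in this
round, so the width bounds are exactly increments of the potential. -/
theorem subsetInstability_le_potential_sub [Fintype C] [Fintype P] {u : C ⊕ P → C ⊕ P → ℝ}
    (hu : u ∈ unstructured C P) {x : ℕ → Finset (C × P)} {e : ℕ → C ⊕ P → ℝ} {T t : ℕ}
    (hL : 1 / 4 ≤ Real.log ((Fintype.card (C ⊕ P) : ℝ) * (T : ℝ)))
    (h : NoiseControlled (Real.log ((Fintype.card (C ⊕ P) : ℝ) * (T : ℝ))) T x e) (ht : t < T)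
    {A : Finset (C ⊕ P)} {τ : C ⊕ P → ℝ}
    (hcm : ComputeMatch A (confidenceSet T x (fun s b => u b (partner (x s) b) + e s b) t)
      (x t) τ) :
    subsetInstability u A (x t) τ ≤
      64 * √(Real.log ((Fintype.card (C ⊕ P) : ℝ) * (T : ℝ))) *
        (matchPotential x (t + 1) - matchPotential x t) := by
  obtain ⟨w, π, hw, ⟨-, -, hπ⟩, hτ⟩ := hcm
  have hmem := mem_confidenceSet hu (by linarith) h ht
  refine (subsetInstability_le_sum_sub hu.1 hw.1 (fun c p => ?_) hπ.1 hτ).trans ?_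
  · exact ⟨((hw.2 c p).1.2 ⟨_, hmem _ _⟩).2 (hmem _ _), ((hw.2 c p).2.2 ⟨_, hmem _ _⟩).2 (hmem _ _)⟩
  set L := Real.log ((Fintype.card (C ⊕ P) : ℝ) * (T : ℝ))
  set G : (C ⊕ P) × (C ⊕ P) → ℝ := fun e => 64 * √L *
    (√((matchedRounds x (t + 1) e.1 e.2).card : ℝ) - √((matchedRounds x t e.1 e.2).card : ℝ))
    with hG
  have hG0 : ∀ e, 0 ≤ G e := fun e => by
    refine mul_nonneg (by positivity) (sub_nonneg.2 (Real.sqrt_le_sqrt ?_))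
    rw [card_matchedRounds_succ]
    exact_mod_cast Nat.le_add_right _ _
  have hrhs : 64 * √L * (matchPotential x (t + 1) - matchPotential x t)
      = ∑ e ∈ (Finset.univ : Finset (C ⊕ P)).offDiag, G e := by
    rw [hG, ← Finset.mul_sum, Finset.sum_sub_distrib, matchPotential, matchPotential]
  have hlhs : ∑ a ∈ A, (w a (partner (x t) a) - u a (partner (x t) a))
      = ∑ a ∈ A.filter (fun a => partner (x t) a ≠ a),
        (w a (partner (x t) a) - u a (partner (x t) a)) := by
    rw [Finset.sum_filter]
    refine Finset.sum_congr rfl fun a _ => ?_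
    split_ifs with h'
    · rfl
    · rw [not_not.1 h', hu.1, hw.1, sub_zero]
  rw [hrhs, hlhs]
  calc _ ≤ ∑ a ∈ A.filter (fun a => partner (x t) a ≠ a), G (a, partner (x t) a) := by
        refine Finset.sum_le_sum fun a ha => ?_
        have hub := isUpperBoundOf_partner hw (Finset.mem_filter.1 ha).2
        have := sub_le_of_mem_confidenceSet hL (hub.2 ⟨_, hmem _ _⟩).1 (hmem _ _)
        simp only [hG, card_matchedRounds_succ, if_true]
        push_cast
        exact this
    _ = ∑ e ∈ (A.filter (fun a => partner (x t) a ≠ a)).image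
          (fun a => (a, partner (x t) a)), G e := by
        rw [Finset.sum_image]
        exact fun a _ b _ h => (Prod.ext_iff.1 h).1
    _ ≤ _ := by
        refine Finset.sum_le_sum_of_subset_of_nonneg ?_ fun e _ _ => hG0 e
        intro e he
        obtain ⟨a, ha, rfl⟩ := Finset.mem_image.1 he
        simpa using (Finset.mem_filter.1 ha).2.symm

theorem matchPotential_le [Fintype C] [Fintype P] {x : ℕ → Finset (C × P)} {T n : ℕ}
    {A : ℕ → Finset (C ⊕ P)} (hx : ∀ t < T, x t ∈ matchings (A t))
    (hA : ∀ t < T, (A t).card ≤ n) :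
    matchPotential x T ≤ (Fintype.card (C ⊕ P) : ℝ) * √((n : ℝ) * T) := by
  have hcount : ∑ e ∈ (Finset.univ : Finset (C ⊕ P)).offDiag, (matchedRounds x T e.1 e.2).card
      ≤ n * T := by
    simp_rw [matchedRounds, Finset.card_filter]
    rw [Finset.sum_comm]
    refine (Finset.sum_le_card_nsmul _ _ n fun t ht => ?_).trans_eq (by simp [mul_comm])
    have ht' := Finset.mem_range.1 ht
    rw [← Finset.card_filter]
    refine le_trans ?_ (hA t ht')
    -- A round raises the count of `(a, a')` only if `a'` is the partner of `a`, so the pair is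
    -- determined by `a`, which must be present.
    refine Finset.card_le_card_of_injOn Prod.fst ?_ ?_
    · rintro ⟨a, a'⟩ he
      simp only [Finset.coe_filter, Finset.mem_offDiag, Set.mem_ofPred_eq] at he
      exact mem_of_partner_ne (hx t ht') (fun h' => he.1.2.2 (h'.symm.trans he.2))
    · rintro ⟨a, a'⟩ he ⟨b, b'⟩ he' (rfl : a = b)
      simp only [Finset.coe_filter, Finset.mem_offDiag, Set.mem_ofPred_eq] at he he'
      rw [← he.2, ← he'.2]
  have hoff : ((Finset.univ : Finset (C ⊕ P)).offDiag.card : ℝ)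
      ≤ (Fintype.card (C ⊕ P) : ℝ) ^ 2 := by
    rw [Finset.offDiag_card, Finset.card_univ, sq]
    exact_mod_cast Nat.sub_le _ _
  have hsq : matchPotential x T ^ 2 ≤ (Fintype.card (C ⊕ P) : ℝ) ^ 2 * ((n : ℝ) * T) := by
    refine (sq_sum_le_card_mul_sum_sq).trans ?_
    simp_rw [Real.sq_sqrt (Nat.cast_nonneg _)]
    gcongr
    exact_mod_cast hcount
  refine (Real.le_sqrt_of_sq_le hsq).trans_eq ?_
  rw [Real.sqrt_mul (by positivity), Real.sqrt_sq (by positivity)]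

end Confidence

/-! ### From the good event to the expected regret. -/

section Regret

variable {C P Ω : Type*} [Fintype C] [Fintype P] [mΩ : MeasurableSpace Ω] {μ : Measure Ω}
  {ℱ : Filtration ℕ mΩ} {u : C ⊕ P → C ⊕ P → ℝ} {ε : ℕ → C ⊕ P → Ω → ℝ} {T n : ℕ}
  {A : ℕ → Ω → Finset (C ⊕ P)} {X : ℕ → Ω → Finset (C × P)} {τ : ℕ → Ω → C ⊕ P → ℝ}

theorem regret_nonneg {C P Ω : Type*} (u : C ⊕ P → C ⊕ P → ℝ) (T : ℕ)
    (A : ℕ → Ω → Finset (C ⊕ P)) (X : ℕ → Ω → Finset (C × P)) (τ : ℕ → Ω → C ⊕ P → ℝ) (ω : Ω) :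
    0 ≤ regret u T A X τ ω :=
  Finset.sum_nonneg fun _ _ => subsetInstability_nonneg _ _ _ _

theorem regret_le_of_noiseControlled (hu : u ∈ unstructured C P)
    (hA : ∀ t < T, ∀ ω, (A t ω).card ≤ n) (hX : IsMatchUCB ℱ u ε T A X τ)
    (hL : 1 / 4 ≤ Real.log ((Fintype.card (C ⊕ P) : ℝ) * (T : ℝ))) {ω : Ω}
    (h : NoiseControlled (Real.log ((Fintype.card (C ⊕ P) : ℝ) * (T : ℝ))) T
      (fun s => X s ω) (fun s a => ε s a ω)) :
    regret u T A X τ ω ≤ 64 * ((Fintype.card (C ⊕ P) : ℝ) *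
      √((n : ℝ) * (T : ℝ) * Real.log ((Fintype.card (C ⊕ P) : ℝ) * (T : ℝ)))) := by
  set L := Real.log ((Fintype.card (C ⊕ P) : ℝ) * (T : ℝ))
  have h1 : regret u T A X τ ω ≤ ∑ t ∈ Finset.range T, 64 * √L *
      (matchPotential (fun s => X s ω) (t + 1) - matchPotential (fun s => X s ω) t) :=
    Finset.sum_le_sum fun t ht =>
      subsetInstability_le_potential_sub hu hL h (Finset.mem_range.1 ht)
        (hX.computeMatch t (Finset.mem_range.1 ht) ω)
  have h0 : matchPotential (fun s => X s ω) 0 = 0 := by simp [matchPotential, matchedRounds]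
  have h2 : matchPotential (fun s => X s ω) T ≤ (Fintype.card (C ⊕ P) : ℝ) * √((n : ℝ) * T) := by
    refine matchPotential_le (A := fun t => A t ω) (fun t ht => ?_) fun t ht => hA t ht ω
    obtain ⟨w, π, -, ⟨hm, -⟩, -⟩ := hX.computeMatch t ht ω
    exact hm
  rw [← Finset.mul_sum, Finset.sum_range_sub, h0, sub_zero] at h1
  refine h1.trans ((mul_le_mul_of_nonneg_left h2 (by positivity)).trans_eq ?_)
  rw [Real.sqrt_mul (by positivity) L]
  ring

/-- A fallback on the failure event, also giving integrability. The factor `√n` makes its product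
with a failure probability of order `1/M` match the target rate. -/
theorem regret_le_of_bounded_arrivals (hu : u ∈ unstructured C P)
    (hA : ∀ t < T, ∀ ω, (A t ω).card ≤ n) (hX : IsMatchUCB ℱ u ε T A X τ) (ω : Ω) :
    regret u T A X τ ω ≤ 3 * √(n : ℝ) * ((Fintype.card (C ⊕ P) : ℝ) * T) := by
  have hcard : ∀ t < T, ((A t ω).card : ℝ) ≤ √(n : ℝ) * Fintype.card (C ⊕ P) := by
    intro t ht
    rcases Nat.eq_zero_or_pos n with hn | hn
    · have := hA t ht ω
      rw [hn, Nat.le_zero] at this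
      rw [this, Nat.cast_zero]
      positivity
    · have h1 : (1 : ℝ) ≤ √(n : ℝ) := Real.one_le_sqrt.2 (by exact_mod_cast hn)
      have h2 : ((A t ω).card : ℝ) ≤ Fintype.card (C ⊕ P) := by
        exact_mod_cast Finset.card_le_univ _
      nlinarith
  calc regret u T A X τ ω
      ≤ ∑ t ∈ Finset.range T, 3 * (√(n : ℝ) * Fintype.card (C ⊕ P)) :=
        Finset.sum_le_sum fun t ht => by
          have ht' := Finset.mem_range.1 ht
          linarith [subsetInstability_le_card hu (hX.computeMatch t ht' ω), hcard t ht']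
    _ = _ := by
        rw [Finset.sum_const, Finset.card_range, nsmul_eq_mul]
        ring

theorem measurable_subsetInstability_transfers {C P : Type*} (u : C ⊕ P → C ⊕ P → ℝ)
    (A : Finset (C ⊕ P)) (X : Finset (C × P)) :
    Measurable fun τ : C ⊕ P → ℝ => subsetInstability u A X τ := by
  have hA : A.powerset.Nonempty := ⟨∅, Finset.empty_mem_powerset A⟩
  set f : Finset (C ⊕ P) → (C ⊕ P → ℝ) → ℝ := fun S τ =>
    maxWeight u S - ∑ a ∈ S, (u a (partner X a) + τ a) with hf
  have hfm : ∀ S ∈ A.powerset, Measurable (f S) := fun S _ =>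
    (Finset.measurable_fun_sum S fun a _ => (measurable_pi_apply a).const_add _).const_sub _
  have heq : (fun τ => subsetInstability u A X τ) = A.powerset.sup' hA f := by
    funext τ
    rw [Finset.sup'_apply, subsetInstability]
  rw [heq]
  exact Finset.measurable_sup' hA hfm

theorem measurable_of_countable_parameter {Ω ι β : Type*} [MeasurableSpace Ω]
    [MeasurableSpace β] [Countable ι] {g : Ω → ι} (hg : ∀ i, MeasurableSet {ω | g ω = i})
    {f : ι → Ω → β} (hf : ∀ i, Measurable (f i)) : Measurable fun ω => f (g ω) ω := by
  intro B hB
  have : (fun ω => f (g ω) ω) ⁻¹' B = ⋃ i, {ω | g ω = i} ∩ f i ⁻¹' B := by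
    ext ω
    simp
  rw [this]
  exact MeasurableSet.iUnion fun i => (hg i).inter (hf i hB)

theorem measurable_subsetInstability {A : Ω → Finset (C ⊕ P)} {X : Ω → Finset (C × P)}
    {τ : Ω → C ⊕ P → ℝ} (hA : ∀ S, MeasurableSet {ω | A ω = S})
    (hX : ∀ S, MeasurableSet {ω | X ω = S}) (hτ : ∀ a, Measurable fun ω => τ ω a) :
    Measurable fun ω => subsetInstability u (A ω) (X ω) (τ ω) :=
  measurable_of_countable_parameter (f := fun S ω => subsetInstability u S (X ω) (τ ω)) hA
    fun S => measurable_of_countable_parameter (f := fun Y ω => subsetInstability u S Y (τ ω)) hX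
      fun Y => (measurable_subsetInstability_transfers u S Y).comp (measurable_pi_iff.2 hτ)

theorem measurable_regret (hX : IsMatchUCB ℱ u ε T A X τ) : Measurable (regret u T A X τ) := by
  refine Finset.measurable_fun_sum _ fun t ht => ?_
  have ht' := Finset.mem_range.1 ht
  exact measurable_subsetInstability (fun S => ℱ.le t _ (hX.measurable_arrivals t ht' S))
    (fun S => ℱ.le t _ (hX.measurable_matching t ht' S))
    fun a => (hX.measurable_transfer t ht' a).mono (ℱ.le t) le_rfl

theorem integrable_regret [IsProbabilityMeasure μ] (hu : u ∈ unstructured C P)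
    (hA : ∀ t < T, ∀ ω, (A t ω).card ≤ n) (hX : IsMatchUCB ℱ u ε T A X τ) :
    Integrable (regret u T A X τ) μ := by
  refine Integrable.of_bound (measurable_regret hX).aestronglyMeasurable
    (3 * √(n : ℝ) * ((Fintype.card (C ⊕ P) : ℝ) * T)) (Filter.Eventually.of_forall fun ω => ?_)
  rw [Real.norm_of_nonneg (regret_nonneg u T A X τ ω)]
  exact regret_le_of_bounded_arrivals hu hA hX ω

/-- Fixing the count `k` makes the threshold deterministic; the two tails come from `ε` and `-ε`. -/
theorem measure_noise_sum_gt_le [IsProbabilityMeasure μ] (hε : IsNoise μ ℱ ε)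
    (hX : ∀ t < T, ∀ S, MeasurableSet[ℱ t] {ω | X t ω = S}) {t k : ℕ} (ht : t ≤ T) (hk : k ≠ 0)
    {L : ℝ} (hL : 0 ≤ L) (a a' : C ⊕ P) :
    μ {ω | (matchedRounds (fun s => X s ω) t a a').card = k ∧
        8 * √(L * k) < |∑ s ∈ matchedRounds (fun s => X s ω) t a a', ε s a ω|}
      ≤ 2 * ENNReal.ofReal (Real.exp (-(32 * L))) := by
  obtain ⟨E, hEdef⟩ : ∃ E : ℕ → Set Ω, ∀ s ω, ω ∈ E s ↔ partner (X s ω) a = a' :=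
    ⟨fun s => {ω | partner (X s ω) a = a'}, fun _ _ => Iff.rfl⟩
  have hE : ∀ s < T, MeasurableSet[ℱ s] (E s) := by
    intro s hs
    have : E s = ⋃ S ∈ {S : Finset (C × P) | partner S a = a'}, {ω | X s ω = S} := by
      ext ω
      simp [hEdef]
    rw [this]
    exact MeasurableSet.biUnion (Set.to_countable _) fun S _ => hX s hs S
  have hind : ∀ s, Indep (MeasurableSpace.comap (ε s a) inferInstance) (ℱ s) μ := fun s =>
    indep_of_indep_of_le_left (hε.nonanticipating s)
      (le_iSup (fun b => MeasurableSpace.comap (ε s b) inferInstance) a)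
  have hpos := measure_sum_gt_le (fun s => hε.subgaussian s a) (fun s => hε.measurable s a)
    (fun s t h => hε.observed s t a h) hind hE ht hk hL
  have hneg := measure_sum_gt_le (ξ := fun s => -ε s a) (fun s => (hε.subgaussian s a).neg)
    (fun s => (hε.measurable s a).neg) (fun s t h => (hε.observed s t a h).neg)
    (fun s => indep_of_indep_of_le_left (hind s) (by
      rintro _ ⟨B, hB, rfl⟩
      exact ⟨Neg.neg ⁻¹' B, measurable_neg hB, rfl⟩)) hE ht hk hL
  have hfil : ∀ ω, (Finset.range t).filter (fun s => ω ∈ E s)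
      = matchedRounds (fun s => X s ω) t a a' := fun ω => by
    ext s
    simp [matchedRounds, hEdef]
  simp only [hfil] at hpos hneg
  rw [two_mul]
  refine le_trans (le_trans (measure_mono ?_) (measure_union_le _ _)) (add_le_add hpos hneg)
  rintro ω ⟨hc, hD⟩
  rcases lt_abs.1 hD with h | h
  · exact Or.inl ⟨hc, h⟩
  · refine Or.inr ⟨hc, ?_⟩
    simp only [Pi.neg_apply, Finset.sum_neg_distrib]
    exact h

theorem measure_not_noiseControlled_le [IsProbabilityMeasure μ] (hε : IsNoise μ ℱ ε)
    (hX : ∀ t < T, ∀ S, MeasurableSet[ℱ t] {ω | X t ω = S})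
    (hM : 1 ≤ (Fintype.card (C ⊕ P) : ℝ) * (T : ℝ)) :
    μ {ω | ¬ NoiseControlled (Real.log ((Fintype.card (C ⊕ P) : ℝ) * (T : ℝ))) T
      (fun s => X s ω) (fun s a => ε s a ω)}
      ≤ ENNReal.ofReal (2 / ((Fintype.card (C ⊕ P) : ℝ) * (T : ℝ))) := by
  set M := (Fintype.card (C ⊕ P) : ℝ) * (T : ℝ) with hMdef
  have hL : 0 ≤ Real.log M := Real.log_nonneg hM
  -- Pairs, rounds `t < T`, and counts `k ≤ t < T`: altogether `M²` events.
  set I : Finset (((C ⊕ P) × (C ⊕ P)) × (ℕ × ℕ)) :=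
    Finset.univ ×ˢ (Finset.range T ×ˢ Finset.range T) with hI
  set B : ((C ⊕ P) × (C ⊕ P)) × (ℕ × ℕ) → Set Ω := fun i =>
    {ω | i.2.2 ≠ 0 ∧ (matchedRounds (fun s => X s ω) i.2.1 i.1.1 i.1.2).card = i.2.2 ∧
      8 * √(Real.log M * i.2.2)
        < |∑ s ∈ matchedRounds (fun s => X s ω) i.2.1 i.1.1 i.1.2, ε s i.1.1 ω|} with hB
  have hsub : {ω | ¬ NoiseControlled (Real.log M) T (fun s => X s ω) (fun s a => ε s a ω)}
      ⊆ ⋃ i ∈ I, B i := by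
    intro ω hω
    simp only [NoiseControlled, Set.mem_ofPred_eq, not_forall, not_le] at hω
    obtain ⟨t, ht, a, a', h0, hD⟩ := hω
    refine Set.mem_biUnion (x := ((a, a'), (t, _))) ?_ ⟨h0, rfl, hD⟩
    have hcard : (matchedRounds (fun s => X s ω) t a a').card ≤ t :=
      (Finset.card_filter_le _ _).trans_eq (Finset.card_range t)
    exact Finset.mem_product.2 ⟨Finset.mem_univ _, Finset.mem_product.2
      ⟨Finset.mem_range.2 ht, Finset.mem_range.2 (hcard.trans_lt ht)⟩⟩
  have hBle : ∀ i ∈ I, μ (B i) ≤ 2 * ENNReal.ofReal (Real.exp (-(32 * Real.log M))) := by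
    rintro ⟨⟨a, a'⟩, t, k⟩ hi
    simp only [hI, Finset.mem_product, Finset.mem_range] at hi
    by_cases hk : k = 0
    · simp [hB, hk]
    · exact (measure_mono fun ω h => h.2).trans
        (measure_noise_sum_gt_le hε hX hi.2.1.le hk hL a a')
  refine (measure_mono hsub).trans ((measure_biUnion_finset_le _ _).trans
    ((Finset.sum_le_card_nsmul _ _ _ hBle).trans ?_))
  have hIcard : (I.card : ℝ) = M ^ 2 := by
    rw [hI, Finset.card_product, Finset.card_product, Finset.card_univ, Fintype.card_prod,
      Finset.card_range, hMdef]
    push_cast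
    ring
  have hM0 : 0 < M := by linarith
  -- Exponent `3` already suffices: `M² · 2/M³ = 2/M`.
  have hexp : Real.exp (-(32 * Real.log M)) ≤ 1 / M ^ 3 := by
    have : 1 / M ^ 3 = Real.exp (-(3 * Real.log M)) := by
      rw [Real.exp_neg, one_div, show 3 * Real.log M = ((3 : ℕ) : ℝ) * Real.log M by norm_num,
        Real.exp_nat_mul, Real.exp_log hM0]
    rw [this]
    exact Real.exp_le_exp.2 (by linarith)
  rw [nsmul_eq_mul, ← ENNReal.ofReal_natCast, show (2 : ENNReal) = ENNReal.ofReal 2 by simp,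
    ← ENNReal.ofReal_mul (by norm_num), ← ENNReal.ofReal_mul (by positivity), hIcard]
  refine ENNReal.ofReal_le_ofReal ?_
  calc M ^ 2 * (2 * Real.exp (-(32 * Real.log M))) ≤ M ^ 2 * (2 * (1 / M ^ 3)) := by gcongr
    _ = 2 / M := by field_simp

theorem integral_regret_le [IsProbabilityMeasure μ] (hu : u ∈ unstructured C P)
    (hε : IsNoise μ ℱ ε) (hA : ∀ t < T, ∀ ω, (A t ω).card ≤ n) (hX : IsMatchUCB ℱ u ε T A X τ)
    (hM : 2 ≤ (Fintype.card (C ⊕ P) : ℝ) * (T : ℝ)) :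
    ∫ ω, regret u T A X τ ω ∂μ ≤ 76 * ((Fintype.card (C ⊕ P) : ℝ) *
      √((n : ℝ) * (T : ℝ) * Real.log ((Fintype.card (C ⊕ P) : ℝ) * (T : ℝ)))) := by
  set M := (Fintype.card (C ⊕ P) : ℝ) * (T : ℝ) with hMdef
  have hL : 1 / 4 ≤ Real.log M := by
    have := Real.log_two_gt_d9
    have := Real.log_le_log (by norm_num) hM
    linarith
  set R := (Fintype.card (C ⊕ P) : ℝ) * √((n : ℝ) * (T : ℝ) * Real.log M) with hR
  -- A measurable hull has the same measure as the failure event, whose own measurability is then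
  -- not needed.
  set D := toMeasurable μ
    {ω | ¬ NoiseControlled (Real.log M) T (fun s => X s ω) (fun s a => ε s a ω)} with hD
  have hDm : MeasurableSet D := measurableSet_toMeasurable _ _
  have hDle : μ.real D ≤ 2 / M := by
    refine ENNReal.toReal_le_of_le_ofReal (by positivity) ?_
    rw [hD, measure_toMeasurable]
    exact measure_not_noiseControlled_le hε hX.measurable_matching (by linarith)
  set Q := 3 * √(n : ℝ) * M with hQ
  have hpt : ∀ ω, regret u T A X τ ω ≤ 64 * R + D.indicator (fun _ => Q) ω := by
    intro ω
    by_cases hω : NoiseControlled (Real.log M) T (fun s => X s ω) (fun s a => ε s a ω)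
    · have h1 := regret_le_of_noiseControlled hu hA hX hL hω
      have h2 : 0 ≤ D.indicator (fun _ => Q) ω :=
        Set.indicator_nonneg (fun _ _ => by positivity) ω
      linarith
    · have h1 := regret_le_of_bounded_arrivals hu hA hX ω
      rw [Set.indicator_of_mem (subset_toMeasurable _ _ hω)]
      have : 0 ≤ R := by positivity
      linarith
  have hIQ : Integrable (D.indicator fun _ => Q) μ := (integrable_const Q).indicator hDm
  have hint : ∫ ω, regret u T A X τ ω ∂μ ≤ 64 * R + μ.real D * Q := by
    refine (integral_mono (integrable_regret hu hA hX) ((integrable_const _).add hIQ)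
      hpt).trans_eq ?_
    simp only [Pi.add_apply]
    rw [integral_add (integrable_const _) hIQ, integral_indicator_const _ hDm]
    simp
  have hQD : μ.real D * Q ≤ 6 * √(n : ℝ) := by
    refine (mul_le_mul_of_nonneg_right hDle (by positivity)).trans_eq ?_
    rw [hQ]
    field_simp
    ring
  have hcard : 1 ≤ (Fintype.card (C ⊕ P) : ℝ) := by
    have : Fintype.card (C ⊕ P) ≠ 0 := fun h0 => by
      rw [hMdef, h0, Nat.cast_zero, zero_mul] at hM
      linarith
    exact_mod_cast Nat.pos_of_ne_zero this
  have hT : 1 ≤ (T : ℝ) := by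
    have : T ≠ 0 := fun h0 => by
      rw [hMdef, h0, Nat.cast_zero, mul_zero] at hM
      linarith
    exact_mod_cast Nat.pos_of_ne_zero this
  -- Since `T ≥ 1` and `log M ≥ 1/4`, `√(T log M) ≥ 1/2`. The total is then `64 R + 6 · 2R = 76 R`.
  have hnR : √(n : ℝ) ≤ 2 * R := by
    have h1 : √(n : ℝ) * (1 / 2) ≤ √((n : ℝ) * (T : ℝ) * Real.log M) := by
      rw [mul_assoc, Real.sqrt_mul (by positivity)]
      refine mul_le_mul_of_nonneg_left (Real.le_sqrt_of_sq_le ?_) (by positivity)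
      nlinarith
    have h2 : √((n : ℝ) * (T : ℝ) * Real.log M) ≤ R :=
      le_mul_of_one_le_left (by positivity) hcard
    linarith
  linarith

/-- Here `log M = 0`, so the claimed bound is `0` and the regret must vanish: either there is no
round, or there is at most one agent and hence no pair. -/
theorem regret_eq_zero_of_card_mul_lt_two (hu : u ∈ unstructured C P)
    (hX : IsMatchUCB ℱ u ε T A X τ) (h : Fintype.card (C ⊕ P) * T < 2) :
    regret u T A X τ = 0 := by
  funext ω
  refine Finset.sum_eq_zero fun t ht => ?_
  have ht' := Finset.mem_range.1 ht
  have : Subsingleton (C ⊕ P) := by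
    rw [← Fintype.card_le_one_iff_subsingleton]
    nlinarith
  exact subsetInstability_eq_zero hu (hX.computeMatch t ht' ω)

end Regret

end MatchTransfers

/-- With an absolute constant `K`: for every finite market, every unstructured utility function,
every independent 1-subgaussian noise, every horizon `T` and every sequence of arrivals with at most
`n` agents per round, every run of MatchUCB has expected regret at most
`K |A| √(n T log (|A| T))`. -/
theorem theorem5p1 :
    ∃ K : ℝ, 0 < K ∧
      ∀ (C : Type u₁) (P : Type u₂) [Fintype C] [Fintype P]
        (Ω : Type u₃) [mΩ : MeasurableSpace Ω] (μ : MeasureTheory.Measure Ω)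
        [MeasureTheory.IsProbabilityMeasure μ] (ℱ : MeasureTheory.Filtration ℕ mΩ)
        (u : C ⊕ P → C ⊕ P → ℝ) (ε : ℕ → C ⊕ P → Ω → ℝ) (T n : ℕ)
        (A : ℕ → Ω → Finset (C ⊕ P)) (X : ℕ → Ω → Finset (C × P)) (τ : ℕ → Ω → C ⊕ P → ℝ),
        u ∈ MatchTransfers.unstructured C P →
        MatchTransfers.IsNoise μ ℱ ε →
        (∀ t < T, ∀ ω, (A t ω).card ≤ n) →
        MatchTransfers.IsMatchUCB ℱ u ε T A X τ →
        MeasureTheory.Integrable (MatchTransfers.regret u T A X τ) μ ∧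
        ∫ ω, MatchTransfers.regret u T A X τ ω ∂μ ≤
          K * ((Fintype.card (C ⊕ P) : ℝ) *
            √((n : ℝ) * (T : ℝ) * Real.log ((Fintype.card (C ⊕ P) : ℝ) * (T : ℝ)))) := by
  refine ⟨76, by norm_num, ?_⟩
  intro C P _ _ Ω mΩ μ _ ℱ u ε T n A X τ hu hε hA hX
  refine ⟨MatchTransfers.integrable_regret hu hA hX, ?_⟩
  rcases lt_or_ge (Fintype.card (C ⊕ P) * T) 2 with h | h
  · rw [MatchTransfers.regret_eq_zero_of_card_mul_lt_two hu hX h]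
    simp only [Pi.zero_apply, integral_zero]
    positivity
  · exact MatchTransfers.integral_regret_le hu hε hA hX (by exact_mod_cast h)
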